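/- Let $M>0$ and $K>0$. For integers $p,n\ge 1$, let $\mathcal F(M)$ be the set of symmetric positive semidefinite matrices $\Sigma\in\mathbb R^{p\times p}$ with largest singular value at most $M$. For $\epsilon\in[0,1]$, $\Sigma\in\mathcal F(M)$ and a Borel probability distribution $Q$ on $\mathbb R^p$, let $\mathbb P_{(\epsilon,\Sigma,Q)}$ denote the law of i.i.d. observations $X_1,\dots,X_n$ from the mixture $(1-\epsilon)N(0,\Sigma)+\epsilon Q$. Let $\|\cdot\|_{\mathrm{op}}$ be the operator norm (largest singular value) and $a\vee b=\max(a,b)$. Then there are constants $C,c>0$, depending only on $M$ and $K$, such that for all $p,n\ge 1$ with $p/n\le K$ and all $\epsilon\in[0,1]$, $$\inf_{\hat\Sigma}\ \sup_{\Sigma\in\mathcal F(M)}\ \sup_{Q}\ \mathbb P_{(\epsilon,\Sigma,Q)}\left\{\|\hat\Sigma-\Sigma\|_{\mathrm{op}}^2\ \ge\ C\left(\frac pn\vee\epsilon^2\right)\right\}\ \ge\ c,$$ where the infimum is over all estimators, i.e. all measurable functions $\hat\Sigma=\hat\Sigma(X_1,\dots,X_n)\in\mathbb R^{p\times p}$,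 and the second supremum is over all Borel probability distributions $Q$ on $\mathbb R^p$. -/

import Mathlib

open MeasureTheory ProbabilityTheory
open scoped ENNReal

noncomputable section

/-- The operator norm of a real `p × p` matrix: its norm as a linear map between Euclidean spaces,
i.e. its largest singular value. -/
def opNorm {p : ℕ} (A : Matrix (Fin p) (Fin p) ℝ) : ℝ :=
  ‖Matrix.toEuclideanCLM (n := Fin p) (𝕜 := ℝ) A‖

/-- The class of symmetric positive semidefinite `p × p` matrices with largest singular value at
most `M`. -/
def boundedSpectrumClass (p : ℕ) (M : ℝ) : Set (Matrix (Fin p) (Fin p) ℝ) :=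
  {S | S.PosSemidef ∧ opNorm S ≤ M}

/-- The contaminated Gaussian distribution `(1 - ε) N(0, S) + ε Q` on `ℝ^p`, for `ε ∈ [0, 1]`. -/
def contaminated {p : ℕ} (ε : ℝ) (S : Matrix (Fin p) (Fin p) ℝ)
    (Q : ProbabilityMeasure (EuclideanSpace ℝ (Fin p))) : Measure (EuclideanSpace ℝ (Fin p)) :=
  ENNReal.ofReal (1 - ε) • multivariateGaussian 0 S
    + ENNReal.ofReal ε • (Q : Measure (EuclideanSpace ℝ (Fin p)))

/-- The joint law of `n` independent observations from the contaminated Gaussian distribution. -/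
def sampleLaw {p : ℕ} (n : ℕ) (ε : ℝ) (S : Matrix (Fin p) (Fin p) ℝ)
    (Q : ProbabilityMeasure (EuclideanSpace ℝ (Fin p))) :
    Measure (Fin n → EuclideanSpace ℝ (Fin p)) :=
  Measure.pi fun _ => contaminated ε S Q

/-- A (nonrandomized) estimator of a `p × p` matrix from `n` observations in `ℝ^p`: a map all of
whose matrix entries are Borel measurable functions of the observations. -/
def CovEstimator (n p : ℕ) : Type :=
  {T : (Fin n → EuclideanSpace ℝ (Fin p)) → Matrix (Fin p) (Fin p) ℝ //
    ∀ i j, Measurable fun x => T x i j}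

/-- The minimax probability, over covariance matrices in the bounded-spectrum class and arbitrary
contaminating distributions, that the squared operator norm error is at least `r`. -/
def minimaxErrorProb (n p : ℕ) (M ε r : ℝ) : ℝ≥0∞ :=
  ⨅ T : CovEstimator n p, ⨆ S ∈ boundedSpectrumClass p M,
    ⨆ Q : ProbabilityMeasure (EuclideanSpace ℝ (Fin p)),
      sampleLaw n ε S Q {x | r ≤ opNorm (T.1 x - S) ^ 2}

end

/-! The maximum is split: each of the two rates is obtained separately, and the larger one is used.

When `p / n` dominates, contamination is useless: every hypothesis gets the same `Q`, and mixing
with a common law does not raise the chi-square bound. For `p = q + 1 ≥ 2`, index covariances by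
signs `v` in a `q`-dimensional cube. The first coordinate is a scaled standard normal plus a
regression on the other `q` coordinates with coefficients `±δ`, where `δ²` is of order `1 / n`. One
sign flip moves a conditional mean by `2δ|z_j|`, so the chi-square divergence of `n` observations
stays bounded. Assouad's lemma then forces a constant fraction of wrong signs, all visible in a
single column of the matrix. The Euclidean norm of a column is at most the operator norm, so the
squared error is of order `q δ²`, that is `p / n`. The condition `p / n ≤ K` keeps `q δ² ≤ 1` and
hence the spectrum bounded. For `p = 1` two variances at relative distance of order `1 / √n` play
the same role, as a cube with one coordinate.

When `ε²` dominates, the sample size is irrelevant: `1 - ε` times a centred Gaussian shrunk by `1 -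
ε` lies below the original Gaussian. The missing mass is a legitimate contamination, so two
covariances at distance at least `M ε` give exactly the same data. -/

/-! ### Chi-square bounds through test functions -/

/-- The second moment of the likelihood ratio of `P'` with respect to `P` is at most `B`
(that is, `χ²(P', P) ≤ B - 1`), expressed through test functions. -/
def ChiSqBound {Ω : Type*} [MeasurableSpace Ω] (P P' : Measure Ω) (B : ℝ≥0∞) : Prop :=
  ∀ f : Ω → ℝ≥0∞, Measurable f → (∫⁻ x, f x ∂P') ^ 2 ≤ B * ∫⁻ x, f x ^ 2 ∂P

theorem lintegral_mul_sq_le {Ω : Type*} [MeasurableSpace Ω] (μ : Measure Ω) {f g : Ω → ℝ≥0∞}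
    (hf : Measurable f) (hg : Measurable g) :
    (∫⁻ x, f x * g x ∂μ) ^ 2 ≤ (∫⁻ x, f x ^ 2 ∂μ) * ∫⁻ x, g x ^ 2 ∂μ := by
  have h := ENNReal.lintegral_mul_le_Lp_mul_Lq μ Real.HolderConjugate.two_two
    hf.aemeasurable hg.aemeasurable
  calc (∫⁻ x, f x * g x ∂μ) ^ 2
      ≤ ((∫⁻ x, f x ^ (2 : ℝ) ∂μ) ^ (1 / (2 : ℝ)) * (∫⁻ x, g x ^ (2 : ℝ) ∂μ) ^ (1 / (2 : ℝ))) ^ 2 :=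
        pow_le_pow_left' h 2
    _ = _ := by
      rw [mul_pow, ← ENNReal.rpow_natCast, ← ENNReal.rpow_natCast, ← ENNReal.rpow_mul,
        ← ENNReal.rpow_mul]
      norm_num

/-- Cauchy–Schwarz for `f √g` and `√k`. Here `g` and `h` may be densities, or conditional integrals
given `x`; the second reading serves the shear family. -/
theorem lintegral_mul_density_sq_le {Ω : Type*} [MeasurableSpace Ω] (μ : Measure Ω)
    {f g h k : Ω → ℝ≥0∞} (hf : Measurable f) (hg : Measurable g) (hk : Measurable k)
    (hgk : ∀ x, h x ^ 2 ≤ g x * k x) :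
    (∫⁻ x, f x * h x ∂μ) ^ 2 ≤ (∫⁻ x, k x ∂μ) * ∫⁻ x, f x ^ 2 * g x ∂μ := by
  have sq : ∀ y : ℝ≥0∞, (y ^ (1 / 2 : ℝ)) ^ 2 = y := fun y => by
    rw [← ENNReal.rpow_natCast, ← ENNReal.rpow_mul]; norm_num
  have h1 : ∀ x, h x ≤ g x ^ (1 / 2 : ℝ) * k x ^ (1 / 2 : ℝ) := fun x => by
    rw [← ENNReal.pow_le_pow_left_iff (n := 2) two_ne_zero, mul_pow, sq, sq]
    exact hgk x
  calc (∫⁻ x, f x * h x ∂μ) ^ 2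
      ≤ (∫⁻ x, (f x * g x ^ (1 / 2 : ℝ)) * k x ^ (1 / 2 : ℝ) ∂μ) ^ 2 := by
        refine pow_le_pow_left' (lintegral_mono fun x => ?_) 2
        simp only [mul_assoc]
        exact mul_le_mul_right (h1 x) _
    _ ≤ _ := lintegral_mul_sq_le μ (hf.mul (hg.pow_const _)) (hk.pow_const _)
    _ = _ := by simp_rw [mul_pow, sq, mul_comm]

namespace ChiSqBound

variable {Ω Ω' : Type*} [MeasurableSpace Ω] [MeasurableSpace Ω'] {P P' : Measure Ω} {B : ℝ≥0∞}

theorem of_density (μ : Measure Ω) {g h k : Ω → ℝ≥0∞} (hg : Measurable g) (hh : Measurable h)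
    (hk : Measurable k) (hgk : ∀ x, h x ^ 2 ≤ g x * k x) :
    ChiSqBound (μ.withDensity g) (μ.withDensity h) (∫⁻ x, k x ∂μ) := fun f hf => by
  rw [lintegral_withDensity_eq_lintegral_mul _ hh hf,
    lintegral_withDensity_eq_lintegral_mul _ hg (hf.pow_const 2)]
  simp only [Pi.mul_apply]
  simp_rw [mul_comm (h _), mul_comm (g _)]
  exact lintegral_mul_density_sq_le μ hf hg hk hgk

theorem mono (h : ChiSqBound P P' B) {B' : ℝ≥0∞} (hB : B ≤ B') : ChiSqBound P P' B' :=
  fun f hf => (h f hf).trans (by gcongr)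

theorem map (h : ChiSqBound P P' B) {g : Ω → Ω'} (hg : Measurable g) :
    ChiSqBound (P.map g) (P'.map g) B := fun f hf => by
  rw [lintegral_map hf hg, lintegral_map (hf.pow_const 2) hg]
  exact h _ (hf.comp hg)

/-- Convexity of the square handles the two components separately; `1 ≤ B` absorbs the common one,
whose own constant is 1. -/
theorem mixture (h : ChiSqBound P P' B) (hB : 1 ≤ B) (Q : Measure Ω) [IsProbabilityMeasure Q]
    {a b : ℝ≥0∞} (hab : a + b = 1) :
    ChiSqBound (a • P + b • Q) (a • P' + b • Q) B := fun f hf => by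
  have hQ : (∫⁻ x, f x ∂Q) ^ 2 ≤ ∫⁻ x, f x ^ 2 ∂Q := by
    simpa using lintegral_mul_sq_le Q hf (measurable_const (a := (1 : ℝ≥0∞)))
  have hc := ENNReal.rpow_arith_mean_le_arith_mean2_rpow a b (∫⁻ x, f x ∂P') (∫⁻ x, f x ∂Q) hab
    (p := 2) one_le_two
  simp only [ENNReal.rpow_ofNat] at hc
  simp only [lintegral_add_measure, lintegral_smul_measure, smul_eq_mul]
  calc _ ≤ _ := hc
    _ ≤ a * (B * ∫⁻ x, f x ^ 2 ∂P) + b * (B * ∫⁻ x, f x ^ 2 ∂Q) := by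
      gcongr
      · exact h f hf
      · exact hQ.trans (le_mul_of_one_le_left' hB)
    _ = _ := by ring

theorem prod [SFinite P] [SFinite P'] {S S' : Measure Ω'} [SFinite S] [SFinite S'] {D : ℝ≥0∞}
    (h : ChiSqBound P P' B) (h' : ChiSqBound S S' D) :
    ChiSqBound (P.prod S) (P'.prod S') (B * D) := fun f hf => by
  rw [lintegral_prod _ hf.aemeasurable, lintegral_prod _ (hf.pow_const 2).aemeasurable]
  calc _ ≤ B * ∫⁻ x, (∫⁻ y, f (x, y) ∂S') ^ 2 ∂P := h _ hf.lintegral_prod_right'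
    _ ≤ B * ∫⁻ x, D * ∫⁻ y, f (x, y) ^ 2 ∂S ∂P := by
      gcongr with x
      exact h' _ (hf.comp measurable_prodMk_left)
    _ = _ := by
      rw [lintegral_const_mul _ (hf.pow_const 2).lintegral_prod_right', mul_assoc]

theorem pi [SigmaFinite P] [SigmaFinite P'] (h : ChiSqBound P P' B) (n : ℕ) :
    ChiSqBound (Measure.pi fun _ : Fin n => P) (Measure.pi fun _ : Fin n => P') (B ^ n) := by
  induction n with
  | zero =>
    intro f hf
    rw [Measure.pi_of_empty, Measure.pi_of_empty]
    simp [lintegral_dirac]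
  | succ n ih =>
    have e := (measurePreserving_piFinSuccAbove (fun _ : Fin (n + 1) => P) 0).symm
    have e' := (measurePreserving_piFinSuccAbove (fun _ : Fin (n + 1) => P') 0).symm
    rw [← e.map_eq, ← e'.map_eq, pow_succ']
    exact (h.prod ih).map (MeasurableEquiv.measurable _)

/-- Testing on an indicator gives `P' E ^ 2 ≤ 2 * P E`. With `x = P' E`, the sum of the two errors
is at least `x² / 2 + 1 - x`, which exceeds `1 / 2` by `(x - 1)² / 2`. -/
theorem half_le_add [IsProbabilityMeasure P] [IsProbabilityMeasure P'] (h : ChiSqBound P P' 2)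
    {E : Set Ω} (hE : MeasurableSet E) : 1 / 2 ≤ P E + P' Eᶜ := by
  have h1 := h (E.indicator 1) (measurable_one.indicator hE)
  have h2 : ∀ x, E.indicator (1 : Ω → ℝ≥0∞) x ^ 2 = E.indicator 1 x := fun x => by
    by_cases hx : x ∈ E <;> simp [hx]
  simp_rw [h2] at h1
  rw [lintegral_indicator_one hE, lintegral_indicator_one hE] at h1
  have hr : P'.real E ^ 2 ≤ 2 * P.real E := by
    have := ENNReal.toReal_mono (by finiteness) h1
    simpa [Measure.real] using this
  rw [← ENNReal.toReal_le_toReal (by simp) (by finiteness),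
    ENNReal.toReal_add (by finiteness) (by finiteness)]
  change _ ≤ P.real E + P'.real Eᶜ
  rw [probReal_compl_eq_one_sub hE]
  norm_num
  nlinarith [sq_nonneg (P'.real E - 1)]

end ChiSqBound

/-! ### Assouad's method -/

/-- Assouad's lemma: if neighbouring hypotheses are hard to separate, every decoder makes many
errors with non-negligible probability under some hypothesis. -/
theorem assouad {Ω ι : Type*} [MeasurableSpace Ω] [Fintype ι] [DecidableEq ι] [Nonempty ι]
    (P : (ι → Bool) → Measure Ω) [∀ v, IsProbabilityMeasure (P v)] (A : ι → Set Ω)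
    (W : (ι → Bool) → ι → Set Ω) (hA : ∀ i, MeasurableSet (A i))
    (hW : ∀ v i, W v i = if v i then (A i)ᶜ else A i)
    (hP : ∀ v i, ∀ E, MeasurableSet E →
      1 / 2 ≤ P v E + P (Function.update v i (!v i)) Eᶜ) :
    ∃ v, 1 / 8 ≤ P v {x | (Fintype.card ι : ℝ≥0∞) / 8 ≤ ∑ i, (W v i).indicator 1 x} := by
  have hWm : ∀ v i, MeasurableSet (W v i) := fun v i => by
    rw [hW]; split_ifs <;> simp [hA]
  have hpair : ∀ i, (Fintype.card (ι → Bool) : ℝ≥0∞) / 4 ≤ ∑ v, P v (W v i) := fun i => by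
    -- Flipping bit `i` is an involution, so summing over `v` counts each pair of neighbours twice;
    -- this turns `1 / 2` into the average `1 / 4`.
    let e : (ι → Bool) ≃ (ι → Bool) :=
      Function.Involutive.toPerm (fun v => Function.update v i (!v i)) (fun v => by
        ext j; by_cases hj : j = i <;> simp [hj])
    have h1 : ∑ v, P (e v) (W (e v) i) = ∑ v, P v (W v i) :=
      Equiv.sum_comp e fun v => P v (W v i)
    have h2 : ∑ v : ι → Bool, (1 / 2 : ℝ≥0∞) ≤ ∑ v, (P v (W v i) + P (e v) (W (e v) i)) := by
      refine Finset.sum_le_sum fun v _ => ?_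
      have : W (e v) i = (W v i)ᶜ := by
        rw [hW, hW]
        have : e v i = !v i := by simp [e, Function.Involutive.toPerm]
        rw [this]
        cases v i <;> simp
      rw [this]
      exact hP v i _ (hWm v i)
    rw [Finset.sum_add_distrib, h1, ← two_mul, Finset.sum_const, Finset.card_univ,
      nsmul_eq_mul] at h2
    calc (Fintype.card (ι → Bool) : ℝ≥0∞) / 4
        = (Fintype.card (ι → Bool) * (1 / 2)) / 2 := by
          rw [one_div, ← div_eq_mul_inv, div_eq_mul_inv, div_eq_mul_inv, div_eq_mul_inv, mul_assoc,
            ← ENNReal.mul_inv (by simp) (by simp)]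
          norm_num
      _ ≤ _ := by
        rw [ENNReal.div_le_iff (by simp) (by simp), mul_comm _ (2 : ℝ≥0∞)]
        exact h2
  have hex : ∃ v, (Fintype.card ι : ℝ≥0∞) / 4 ≤ ∑ i, P v (W v i) := by
    by_contra! hlt
    have h1 : ∑ v, ∑ i, P v (W v i) < ∑ v : ι → Bool, (Fintype.card ι : ℝ≥0∞) / 4 :=
      ENNReal.sum_lt_sum_of_nonempty Finset.univ_nonempty fun v _ => hlt v
    rw [Finset.sum_comm] at h1
    have h2 : ∑ i : ι, (Fintype.card (ι → Bool) : ℝ≥0∞) / 4 ≤ ∑ i, ∑ v, P v (W v i) :=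
      Finset.sum_le_sum fun i _ => hpair i
    refine absurd (h2.trans_lt h1) (not_lt.2 (le_of_eq ?_))
    simp only [Finset.sum_const, Finset.card_univ, nsmul_eq_mul, div_eq_mul_inv]
    ring
  obtain ⟨v, hv⟩ := hex
  refine ⟨v, ?_⟩
  set N : Ω → ℝ≥0∞ := fun x => ∑ i, (W v i).indicator 1 x with hN
  set k : ℝ≥0∞ := (Fintype.card ι : ℝ≥0∞) with hk
  have hk0 : k ≠ 0 := by simp [hk]
  have hkt : k ≠ ∞ := by simp [hk]
  have hNm : Measurable N :=
    Finset.measurable_sum _ fun i _ => measurable_one.indicator (hWm v i)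
  have hNk : ∀ x, N x ≤ k := fun x => by
    calc N x ≤ ∑ i : ι, (1 : ℝ≥0∞) :=
          Finset.sum_le_sum fun i _ => Set.indicator_le_self' (by simp) x
      _ = k := by simp [hk]
  have hint : ∫⁻ x, N x ∂(P v) = ∑ i, P v (W v i) := by
    rw [lintegral_finsetSum _ fun i _ => measurable_one.indicator (hWm v i)]
    simp_rw [lintegral_indicator_one (hWm v _)]
  set G : Set Ω := {x | k / 8 ≤ N x}
  have hG : MeasurableSet G := measurableSet_le measurable_const hNm
  -- Reverse Markov inequality: the error count is at most `k` on `G` and below `k / 8` off it,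
  -- while its mean is at least `k / 4`.
  have hle : ∫⁻ x, N x ∂(P v) ≤ k * P v G + k / 8 := by
    calc ∫⁻ x, N x ∂(P v) ≤ ∫⁻ x, (G.indicator (fun _ => k) x + k / 8) ∂(P v) := by
          gcongr with x
          by_cases hx : x ∈ G
          · simp only [hx, Set.indicator_of_mem]
            exact (hNk x).trans le_self_add
          · simp only [hx, not_false_eq_true, Set.indicator_of_notMem, zero_add]
            exact (not_le.1 hx).le
      _ = _ := by
        rw [lintegral_add_left (measurable_const.indicator hG), lintegral_indicator_const hG]
        simp
  have h8 : k / 8 + k / 8 ≤ k * P v G + k / 8 := by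
    refine le_trans (le_of_eq ?_) (hv.trans (hint ▸ hle))
    rw [← two_mul, ← ENNReal.toReal_eq_toReal_iff' (by finiteness) (by finiteness)]
    simp only [ENNReal.toReal_mul, ENNReal.toReal_div, ENNReal.toReal_ofNat]
    ring
  have h9 := (ENNReal.add_le_add_iff_right (by finiteness)).1 h8
  rw [div_eq_mul_inv] at h9
  rw [one_div]
  exact (ENNReal.mul_le_mul_iff_right hk0 hkt).1 h9

/-! ### One-dimensional Gaussian computations -/

/-- Completing the square: the second density squared over the first is a constant times the
Gaussian density centred at `2 * m' - m`. -/
theorem chiSqBound_gaussianReal_mean (m m' : ℝ) :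
    ChiSqBound (gaussianReal m 1) (gaussianReal m' 1)
      (ENNReal.ofReal (Real.exp ((m' - m) ^ 2))) := by
  have hk : ∫⁻ x, ENNReal.ofReal (Real.exp ((m' - m) ^ 2)) * gaussianPDF (2 * m' - m) 1 x =
      ENNReal.ofReal (Real.exp ((m' - m) ^ 2)) := by
    rw [lintegral_const_mul _ (measurable_gaussianPDF _ _), lintegral_gaussianPDF_eq_one _ one_ne_zero,
      mul_one]
  rw [← hk, gaussianReal_of_var_ne_zero _ one_ne_zero, gaussianReal_of_var_ne_zero _ one_ne_zero]
  refine ChiSqBound.of_density _ (measurable_gaussianPDF _ _) (measurable_gaussianPDF _ _)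
    ((measurable_gaussianPDF _ _).const_mul _) fun x => le_of_eq ?_
  simp only [gaussianPDF]
  rw [← ENNReal.ofReal_pow (gaussianPDFReal_nonneg _ _ _), ← ENNReal.ofReal_mul (by positivity),
    ← ENNReal.ofReal_mul (gaussianPDFReal_nonneg _ _ _)]
  congr 1
  simp only [gaussianPDFReal, NNReal.coe_one, mul_one]
  have hexp : Real.exp (-(x - m') ^ 2 / 2) ^ 2 = Real.exp ((m' - m) ^ 2) *
      Real.exp (-(x - m) ^ 2 / 2) * Real.exp (-(x - (2 * m' - m)) ^ 2 / 2) := by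
    rw [← Real.exp_nat_mul, ← Real.exp_add, ← Real.exp_add]
    congr 1
    push_cast
    ring
  rw [mul_pow, hexp]
  ring

/-- The same quotient is again Gaussian; its precision is `2 / (1 - t) - 1`, hence the variance `(1
- t) / (1 + t)`. -/
theorem chiSqBound_gaussianReal_var {t : NNReal} (ht0 : 0 < t) (ht : t < 1) :
    ChiSqBound (gaussianReal 0 1) (gaussianReal 0 (1 - t))
      (ENNReal.ofReal (√(1 - (t : ℝ) ^ 2))⁻¹) := by
  have hv : 1 - t ≠ 0 := (tsub_pos_of_lt ht).ne'
  have hvt : ((1 - t : NNReal) : ℝ) = 1 - t := by rw [NNReal.coe_sub ht.le]; rfl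
  have ht' : (t : ℝ) < 1 := ht
  have ht0' : (0 : ℝ) < t := ht0
  have hw : (1 - t) / (1 + t) ≠ 0 := div_ne_zero hv (by positivity)
  have hk : ∫⁻ x, ENNReal.ofReal (√(1 - (t : ℝ) ^ 2))⁻¹ * gaussianPDF 0 ((1 - t) / (1 + t)) x =
      ENNReal.ofReal (√(1 - (t : ℝ) ^ 2))⁻¹ := by
    rw [lintegral_const_mul _ (measurable_gaussianPDF _ _), lintegral_gaussianPDF_eq_one _ hw,
      mul_one]
  rw [← hk, gaussianReal_of_var_ne_zero _ one_ne_zero, gaussianReal_of_var_ne_zero _ hv]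
  refine ChiSqBound.of_density _ (measurable_gaussianPDF _ _) (measurable_gaussianPDF _ _)
    ((measurable_gaussianPDF _ _).const_mul _) fun x => le_of_eq ?_
  simp only [gaussianPDF]
  rw [← ENNReal.ofReal_pow (gaussianPDFReal_nonneg _ _ _), ← ENNReal.ofReal_mul (by positivity),
    ← ENNReal.ofReal_mul (gaussianPDFReal_nonneg _ _ _)]
  congr 1
  simp only [gaussianPDFReal, NNReal.coe_one, mul_one, NNReal.coe_div, NNReal.coe_add, hvt, sub_zero]
  have h1 : (0 : ℝ) < 1 - t := by linarith
  have h2 : (0 : ℝ) < 1 + t := by linarith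
  have hpi := Real.pi_pos
  have hexp : Real.exp (-x ^ 2 / (2 * (1 - t))) ^ 2 = Real.exp (-x ^ 2 / 2) *
      Real.exp (-x ^ 2 / (2 * ((1 - t) / (1 + t)))) := by
    rw [← Real.exp_nat_mul, ← Real.exp_add]
    congr 1
    field_simp
    ring
  have hc : (√(2 * Real.pi * (1 - t)))⁻¹ ^ 2 = (√(2 * Real.pi))⁻¹ * ((√(1 - (t : ℝ) ^ 2))⁻¹ *
      (√(2 * Real.pi * ((1 - t) / (1 + t))))⁻¹) := by
    rw [← mul_inv, ← mul_inv, ← Real.sqrt_mul (by nlinarith), ← Real.sqrt_mul (by positivity),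
      inv_pow, Real.sq_sqrt (by positivity)]
    congr 1
    rw [eq_comm, Real.sqrt_eq_iff_mul_self_eq (by have : 0 ≤ 1 - (t:ℝ)^2 := by nlinarith
                                                  positivity) (by positivity)]
    field_simp
    ring
  rw [mul_pow, hexp, hc]
  ring

theorem lintegral_exp_sq_gaussianReal {t : ℝ} (ht : t < 1 / 2) :
    ∫⁻ x, ENNReal.ofReal (Real.exp (t * x ^ 2)) ∂(gaussianReal 0 1) =
      ENNReal.ofReal (√(1 - 2 * t))⁻¹ := by
  have h1 : 0 < 1 - 2 * t := by linarith
  set w : NNReal := ⟨(1 - 2 * t)⁻¹, by positivity⟩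
  have hwc : (w : ℝ) = (1 - 2 * t)⁻¹ := rfl
  have hw0 : w ≠ 0 := by
    rw [Ne, ← NNReal.coe_eq_zero]; exact (inv_pos.2 h1).ne'
  rw [gaussianReal_of_var_ne_zero _ one_ne_zero,
    lintegral_withDensity_eq_lintegral_mul _ (measurable_gaussianPDF _ _) (by fun_prop)]
  have : ∀ x, (gaussianPDF 0 1 * fun x => ENNReal.ofReal (Real.exp (t * x ^ 2))) x =
      ENNReal.ofReal (√(1 - 2 * t))⁻¹ * gaussianPDF 0 w x := fun x => by
    simp only [gaussianPDF, Pi.mul_apply]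
    rw [← ENNReal.ofReal_mul (gaussianPDFReal_nonneg _ _ _), ← ENNReal.ofReal_mul (by positivity)]
    congr 1
    simp only [gaussianPDFReal, NNReal.coe_one, mul_one, sub_zero, hwc]
    rw [mul_assoc, ← Real.exp_add, ← mul_assoc, ← mul_inv, ← Real.sqrt_mul h1.le]
    congr 3
    · field_simp
    · field_simp
      ring
  simp_rw [this]
  rw [lintegral_const_mul _ (measurable_gaussianPDF _ _), lintegral_gaussianPDF_eq_one _ hw0, mul_one]

/-- A narrower centred Gaussian is dominated by a wider one, up to the ratio of the scales. -/
theorem smul_gaussianReal_le {a : ℝ} (ha0 : 0 ≤ a) (ha : a ≤ 1) :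
    ENNReal.ofReal a • (gaussianReal 0 1).map (a * ·) ≤ gaussianReal 0 1 := by
  rcases ha0.eq_or_lt with rfl | ha0
  · simpa using Measure.zero_le _
  rw [gaussianReal_map_const_mul]
  have hv : (.mk (a ^ 2) (sq_nonneg _) * 1 : NNReal) ≠ 0 := by
    rw [Ne, ← NNReal.coe_eq_zero]; simp [ha0.ne']
  rw [mul_zero, gaussianReal_of_var_ne_zero _ hv, gaussianReal_of_var_ne_zero _ one_ne_zero,
    ← withDensity_smul _ (measurable_gaussianPDF _ _)]
  refine withDensity_mono (Filter.Eventually.of_forall fun x => ?_)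
  simp only [Pi.smul_apply, smul_eq_mul, gaussianPDF]
  rw [← ENNReal.ofReal_mul ha0.le]
  refine ENNReal.ofReal_le_ofReal ?_
  simp only [gaussianPDFReal, NNReal.coe_one, mul_one, sub_zero, NNReal.coe_mk]
  rw [Real.sqrt_mul (by positivity), Real.sqrt_sq ha0.le, mul_inv, ← mul_assoc, mul_left_comm,
    mul_inv_cancel₀ ha0.ne', mul_one]
  refine mul_le_mul_of_nonneg_left (Real.exp_le_exp.2 ?_) (by positivity)
  rw [div_le_div_iff₀ (by positivity) (by positivity)]
  nlinarith [sq_nonneg x, mul_nonneg (sq_nonneg x) (show 0 ≤ 1 - a ^ 2 by nlinarith)]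

/-! ### Gaussian images, contaminated laws and the operator norm -/

open Matrix in
theorem multivariateGaussian_mul_transpose {p : ℕ} (L : Matrix (Fin p) (Fin p) ℝ) :
    multivariateGaussian 0 (L * Lᵀ) =
      (stdGaussian (EuclideanSpace ℝ (Fin p))).map (toEuclideanCLM (n := Fin p) (𝕜 := ℝ) L) := by
  have hps : (L * Lᵀ).PosSemidef := by
    simpa using posSemidef_self_mul_conjTranspose L
  apply Measure.ext_of_charFun
  ext x
  rw [charFun_multivariateGaussian hps, charFun_apply, integral_map (by fun_prop) (by fun_prop)]
  have h : ∀ y : EuclideanSpace ℝ (Fin p), inner ℝ (toEuclideanCLM (n := Fin p) (𝕜 := ℝ) L y) x =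
      inner ℝ y (toEuclideanCLM (n := Fin p) (𝕜 := ℝ) Lᵀ x) := fun y => by
    rw [real_inner_comm, inner_toEuclideanCLM, inner_toEuclideanCLM, dotProduct_mulVec,
      ← mulVec_transpose, dotProduct_comm]
  simp_rw [h]
  rw [← charFun_apply, charFun_stdGaussian, ← Complex.ofReal_pow, ← real_inner_self_eq_norm_sq,
    inner_toEuclideanCLM, ofLp_toEuclideanCLM, ← mulVec_mulVec, inner_zero_right]
  rw [mulVec_transpose, ← dotProduct_mulVec, dotProduct_mulVec x.ofLp L]
  simp [neg_div]

theorem ofReal_one_sub_add_ofReal {ε : ℝ} (hε0 : 0 ≤ ε) (hε1 : ε ≤ 1) :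
    ENNReal.ofReal (1 - ε) + ENNReal.ofReal ε = 1 := by
  rw [← ENNReal.ofReal_add (by linarith) hε0]; simp

theorem isProbabilityMeasure_contaminated {p : ℕ} {ε : ℝ} (hε0 : 0 ≤ ε) (hε1 : ε ≤ 1)
    (S : Matrix (Fin p) (Fin p) ℝ) (Q : ProbabilityMeasure (EuclideanSpace ℝ (Fin p))) :
    IsProbabilityMeasure (contaminated ε S Q) := by
  constructor
  simp [contaminated, ofReal_one_sub_add_ofReal hε0 hε1]

theorem isProbabilityMeasure_sampleLaw {p : ℕ} (n : ℕ) {ε : ℝ} (hε0 : 0 ≤ ε) (hε1 : ε ≤ 1)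
    (S : Matrix (Fin p) (Fin p) ℝ) (Q : ProbabilityMeasure (EuclideanSpace ℝ (Fin p))) :
    IsProbabilityMeasure (sampleLaw n ε S Q) := by
  have := isProbabilityMeasure_contaminated hε0 hε1 S Q
  unfold sampleLaw
  infer_instance

theorem opNorm_nonneg {p : ℕ} (A : Matrix (Fin p) (Fin p) ℝ) : 0 ≤ opNorm A := norm_nonneg _

theorem opNorm_add_le {p : ℕ} (A B : Matrix (Fin p) (Fin p) ℝ) :
    opNorm (A + B) ≤ opNorm A + opNorm B := by
  unfold opNorm
  rw [map_add]
  exact norm_add_le _ _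

theorem opNorm_sub_comm {p : ℕ} (A B : Matrix (Fin p) (Fin p) ℝ) :
    opNorm (A - B) = opNorm (B - A) := by
  unfold opNorm
  rw [map_sub, map_sub, norm_sub_rev]

theorem sum_col_sq_le_opNorm_sq {p : ℕ} (A : Matrix (Fin p) (Fin p) ℝ) (j : Fin p) :
    ∑ i, A i j ^ 2 ≤ opNorm A ^ 2 := by
  have h := (Matrix.toEuclideanCLM (n := Fin p) (𝕜 := ℝ) A).le_opNorm
    (EuclideanSpace.single j 1)
  rw [PiLp.norm_single, norm_one, mul_one] at h
  calc ∑ i, A i j ^ 2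
      = ‖Matrix.toEuclideanCLM (n := Fin p) (𝕜 := ℝ) A (EuclideanSpace.single j 1)‖ ^ 2 := by
        rw [EuclideanSpace.norm_sq_eq]
        simp
    _ ≤ _ := by unfold opNorm; gcongr

theorem abs_entry_le_opNorm {p : ℕ} (A : Matrix (Fin p) (Fin p) ℝ) (i j : Fin p) :
    |A i j| ≤ opNorm A :=
  abs_le_of_sq_le_sq ((Finset.single_le_sum (f := fun i => A i j ^ 2) (fun _ _ => sq_nonneg _)
    (Finset.mem_univ i)).trans (sum_col_sq_le_opNorm_sq A j)) (opNorm_nonneg A)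

/-! ### Reduction to families of hypotheses -/

/-- Thresholding column `j₀` of the estimate at `a` decodes `v`. Each wrong bit costs at least `d ^
2` in that column, and Assouad supplies `card ι / 8` wrong bits. -/
theorem le_minimaxErrorProb_of_hypercube {ι : Type*} [Fintype ι] [DecidableEq ι] [Nonempty ι]
    {n p : ℕ} {M ε r a d : ℝ} {B : ℝ≥0∞} (hε0 : 0 ≤ ε) (hε1 : ε ≤ 1) (hd : 0 ≤ d)
    (S : (ι → Bool) → Matrix (Fin p) (Fin p) ℝ) (hS : ∀ v, S v ∈ boundedSpectrumClass p M)
    (τ : ι → Fin p) (hτ : Function.Injective τ) (j₀ : Fin p)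
    (hSτ : ∀ v i, S v (τ i) j₀ = if v i then a + d else a - d)
    (hB1 : 1 ≤ B) (hBn : B ^ n ≤ 2)
    (hchi : ∀ v i, v i = true →
      ChiSqBound (multivariateGaussian 0 (S v))
        (multivariateGaussian 0 (S (Function.update v i false))) B)
    (hr : r ≤ d ^ 2 * (Fintype.card ι / 8)) :
    1 / 8 ≤ minimaxErrorProb n p M ε r := by
  refine le_iInf fun T => ?_
  let Q : ProbabilityMeasure (EuclideanSpace ℝ (Fin p)) := ⟨Measure.dirac 0, inferInstance⟩
  have hprob := fun v => isProbabilityMeasure_sampleLaw n hε0 hε1 (S v) Q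
  let A : ι → Set (Fin n → EuclideanSpace ℝ (Fin p)) := fun i => {x | a ≤ T.1 x (τ i) j₀}
  have hA : ∀ i, MeasurableSet (A i) := fun i => measurableSet_le measurable_const (T.2 _ _)
  have hsep : ∀ v i, v i = true → ∀ E, MeasurableSet E →
      1 / 2 ≤ sampleLaw n ε (S v) Q E
        + sampleLaw n ε (S (Function.update v i false)) Q Eᶜ := fun v i hvi E hE => by
    have := fun v => isProbabilityMeasure_contaminated hε0 hε1 (S v) Q
    have hmix : ChiSqBound (contaminated ε (S v) Q)
        (contaminated ε (S (Function.update v i false)) Q) B :=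
      (hchi v i hvi).mixture hB1 Q.1 (ofReal_one_sub_add_ofReal hε0 hε1)
    have := hprob v
    have := hprob (Function.update v i false)
    exact ((hmix.pi n).mono hBn).half_le_add (P := sampleLaw n ε (S v) Q)
      (P' := sampleLaw n ε (S (Function.update v i false)) Q) hE
  obtain ⟨v, hv⟩ := assouad (fun v => sampleLaw n ε (S v) Q) A
    (fun v i => if v i then (A i)ᶜ else A i) hA (fun _ _ => rfl) fun v i E hE => by
      cases hvi : v i
      -- The chi-square bound goes only from `true` to `false`; the other direction follows by
      -- exchanging the test with its complement.
      · have h := hsep (Function.update v i true) i (by simp) Eᶜ hE.compl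
        rw [Function.update_idem, ← hvi, Function.update_eq_self, compl_compl, add_comm] at h
        simpa using h
      · exact hsep v i hvi E hE
  refine hv.trans (le_iSup₂_of_le (S v) (hS v) (le_iSup_of_le Q (measure_mono fun x hx => ?_)))
  have hi : ∀ i, ENNReal.ofReal (d ^ 2) * (if v i then (A i)ᶜ else A i).indicator 1 x ≤
      ENNReal.ofReal ((T.1 x - S v) (τ i) j₀ ^ 2) := fun i => by
    by_cases hx : x ∈ (if v i then (A i)ᶜ else A i)
    · rw [Set.indicator_of_mem hx, Pi.one_apply, mul_one, Matrix.sub_apply, hSτ]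
      refine ENNReal.ofReal_le_ofReal ?_
      cases hvi : v i <;> simp only [hvi, if_true, if_false, A, Set.mem_compl_iff,
        Set.mem_ofPred_eq, not_le, Bool.false_eq_true] at hx ⊢ <;> nlinarith
    · simp [Set.indicator_of_notMem hx]
  have hsum : ENNReal.ofReal (d ^ 2 * (Fintype.card ι / 8)) ≤
      ENNReal.ofReal (opNorm (T.1 x - S v) ^ 2) := by
    calc ENNReal.ofReal (d ^ 2 * (Fintype.card ι / 8))
        = ENNReal.ofReal (d ^ 2) * (Fintype.card ι / 8) := by
          rw [ENNReal.ofReal_mul (sq_nonneg d), ENNReal.ofReal_div_of_pos (by norm_num)]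
          simp
      _ ≤ ENNReal.ofReal (d ^ 2) * ∑ i, (if v i then (A i)ᶜ else A i).indicator 1 x := by
          gcongr
          exact hx
      _ ≤ ∑ i, ENNReal.ofReal ((T.1 x - S v) (τ i) j₀ ^ 2) := by
          rw [Finset.mul_sum]
          exact Finset.sum_le_sum fun i _ => hi i
      _ = ENNReal.ofReal (∑ k ∈ Finset.univ.map ⟨τ, hτ⟩, (T.1 x - S v) k j₀ ^ 2) := by
          rw [Finset.sum_map, ENNReal.ofReal_sum_of_nonneg fun _ _ => sq_nonneg _]
          rfl
      _ ≤ ENNReal.ofReal (∑ k, (T.1 x - S v) k j₀ ^ 2) :=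
          ENNReal.ofReal_le_ofReal (Finset.sum_le_univ_sum_of_nonneg fun _ => sq_nonneg _)
      _ ≤ _ := ENNReal.ofReal_le_ofReal (sum_col_sq_le_opNorm_sq _ _)
  exact hr.trans ((ENNReal.ofReal_le_ofReal_iff (sq_nonneg _)).1 hsum)

/-- By the triangle inequality no estimate is within `d` of both matrices, so under the common law
one of the two error events has probability at least `1 / 2`. -/
theorem le_minimaxErrorProb_of_contaminated_eq {n p : ℕ} {M ε r d : ℝ} (hε0 : 0 ≤ ε) (hε1 : ε ≤ 1)
    {S S' : Matrix (Fin p) (Fin p) ℝ} (hS : S ∈ boundedSpectrumClass p M)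
    (hS' : S' ∈ boundedSpectrumClass p M) (Q Q' : ProbabilityMeasure (EuclideanSpace ℝ (Fin p)))
    (h : contaminated ε S Q = contaminated ε S' Q') (hd : 0 ≤ d) (hSS' : 2 * d ≤ opNorm (S - S'))
    (hr : r ≤ d ^ 2) : 1 / 2 ≤ minimaxErrorProb n p M ε r := by
  refine le_iInf fun T => ?_
  have hprob := isProbabilityMeasure_sampleLaw n hε0 hε1 S Q
  set E := {x | r ≤ opNorm (T.1 x - S) ^ 2}
  set E' := {x | r ≤ opNorm (T.1 x - S') ^ 2}
  have hcover : E ∪ E' = Set.univ := by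
    refine Set.eq_univ_of_forall fun x => ?_
    by_contra hx
    simp only [E, E', Set.mem_union, Set.mem_ofPred_eq, not_or, not_le] at hx
    have h1 := abs_lt_of_sq_lt_sq (hx.1.trans_le hr) hd
    have h2 := abs_lt_of_sq_lt_sq (hx.2.trans_le hr) hd
    have h3 := opNorm_add_le (S - T.1 x) (T.1 x - S')
    rw [sub_add_sub_cancel, opNorm_sub_comm S (T.1 x)] at h3
    linarith [le_abs_self (opNorm (T.1 x - S)), le_abs_self (opNorm (T.1 x - S'))]
  have hsum : 1 ≤ sampleLaw n ε S Q E + sampleLaw n ε S' Q' E' := by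
    have : sampleLaw n ε S' Q' = sampleLaw n ε S Q := by unfold sampleLaw; rw [h]
    rw [this, ← measure_univ (μ := sampleLaw n ε S Q), ← hcover]
    exact measure_union_le _ _
  have hsup : ∀ {R} (_ : R ∈ boundedSpectrumClass p M) (V), sampleLaw n ε R V
      {x | r ≤ opNorm (T.1 x - R) ^ 2} ≤ ⨆ S ∈ boundedSpectrumClass p M,
        ⨆ Q : ProbabilityMeasure (EuclideanSpace ℝ (Fin p)),
          sampleLaw n ε S Q {x | r ≤ opNorm (T.1 x - S) ^ 2} := fun {R} hR V =>
    le_iSup₂_of_le R hR (le_iSup_of_le V le_rfl)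
  rw [ENNReal.div_le_iff (by simp) (by simp), mul_two]
  exact hsum.trans (add_le_add (hsup hS Q) (hsup hS' Q'))

theorem exists_contamination {Ω : Type*} [MeasurableSpace Ω] (P P' : Measure Ω)
    [IsProbabilityMeasure P] [IsProbabilityMeasure P'] {ε : ℝ} (hε0 : 0 < ε) (hε1 : ε ≤ 1)
    (h : ENNReal.ofReal (1 - ε) • P' ≤ P) :
    ∃ Q : ProbabilityMeasure Ω,
      ENNReal.ofReal (1 - ε) • P' + ENNReal.ofReal ε • (Q : Measure Ω) = P := by
  have hε : ENNReal.ofReal ε ≠ 0 := by simpa using hε0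
  have := IsFiniteMeasure.mk (μ := ENNReal.ofReal (1 - ε) • P') (by simp)
  have hQ : (P - ENNReal.ofReal (1 - ε) • P') Set.univ = ENNReal.ofReal ε := by
    rw [Measure.sub_apply MeasurableSet.univ h]
    simp only [measure_univ, Measure.smul_apply, smul_eq_mul, mul_one]
    rw [← ofReal_one_sub_add_ofReal hε0.le hε1]
    exact ENNReal.add_sub_cancel_left (by simp)
  refine ⟨⟨(ENNReal.ofReal ε)⁻¹ • (P - ENNReal.ofReal (1 - ε) • P'), ⟨?_⟩⟩, ?_⟩
  · rw [Measure.smul_apply, hQ, smul_eq_mul, ENNReal.inv_mul_cancel hε (by simp)]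
  · rw [ProbabilityMeasure.coe_mk, smul_smul, ENNReal.mul_inv_cancel hε (by simp), one_smul,
      add_comm, Measure.sub_add_cancel_of_le h]

/-! ### Rank-one and shear covariances -/

theorem measurable_euclideanSpace_single {p : ℕ} (i : Fin p) :
    Measurable fun y : ℝ => (EuclideanSpace.single i y : EuclideanSpace ℝ (Fin p)) := by
  refine (WithLp.measurable_toLp 2 _).comp (measurable_pi_lambda _ fun k => ?_)
  by_cases hk : k = i
  · subst hk; simpa using measurable_id'
  · simp [hk]

theorem multivariateGaussian_single {p : ℕ} (i : Fin p) (b : ℝ) :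
    multivariateGaussian 0 (Matrix.single i i (b ^ 2)) =
      ((gaussianReal 0 1).map (b * ·)).map fun y : ℝ => EuclideanSpace.single i y := by
  have hL : Matrix.single i i (b ^ 2) =
      Matrix.single i i b * (Matrix.single i i b).transpose := by
    rw [Matrix.transpose_single, Matrix.single_mul_single_same, sq]
  have he : (Measure.pi fun _ : Fin p => gaussianReal 0 1).map (fun x : Fin p → ℝ => x i) =
      gaussianReal 0 1 := (measurePreserving_eval (fun _ : Fin p => gaussianReal 0 1) i).map_eq
  have hm := measurable_euclideanSpace_single i
  rw [hL, multivariateGaussian_mul_transpose, ← map_pi_eq_stdGaussian,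
    Measure.map_map (by fun_prop) (by fun_prop)]
  conv_rhs => rw [← he]
  rw [Measure.map_map hm (by fun_prop),
    Measure.map_map (hm.comp (measurable_const_mul b)) (by fun_prop)]
  congr 1
  ext x k
  by_cases hk : k = i <;> simp [hk, Matrix.mulVec, dotProduct, Matrix.single_apply, Ne.symm]

theorem single_mem_boundedSpectrumClass {p : ℕ} (i : Fin p) {b M : ℝ} (hb0 : 0 ≤ b) (hb : b ≤ M) :
    Matrix.single i i b ∈ boundedSpectrumClass p M := by
  constructor
  · rw [← Matrix.diagonal_single]
    exact Matrix.PosSemidef.diagonal (Pi.single_nonneg.2 hb0)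
  · refine ContinuousLinearMap.opNorm_le_bound _ (hb0.trans hb) fun x => ?_
    have : Matrix.toEuclideanCLM (n := Fin p) (𝕜 := ℝ) (Matrix.single i i b) x =
        EuclideanSpace.single i (b * x i) := by
      ext k
      by_cases hk : k = i <;> simp [hk, Matrix.mulVec, dotProduct, Matrix.single_apply, Ne.symm]
    rw [this, PiLp.norm_single, norm_mul, Real.norm_of_nonneg hb0]
    exact mul_le_mul hb (PiLp.norm_apply_le x i) (norm_nonneg _) (hb0.trans hb)

/-- The matrix of the map `z ↦ s • (z₀ + ∑ j, w j * z (j + 1), z₁, …, z_q)`. -/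
def shearMatrix {q : ℕ} (s : ℝ) (w : Fin q → ℝ) : Matrix (Fin (q + 1)) (Fin (q + 1)) ℝ :=
  s • (1 + Matrix.vecMulVec (Pi.single 0 1) (Fin.cons 0 w))

theorem shearMatrix_apply_zero {q : ℕ} (s : ℝ) (w : Fin q → ℝ) (k : Fin q) :
    shearMatrix s w 0 k.succ = s * w k := by
  simp [shearMatrix, Matrix.vecMulVec_apply, (Fin.succ_ne_zero k).symm]

theorem shearMatrix_apply_zero_zero {q : ℕ} (s : ℝ) (w : Fin q → ℝ) :
    shearMatrix s w 0 0 = s := by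
  simp [shearMatrix, Matrix.vecMulVec_apply]

theorem shearMatrix_apply_succ {q : ℕ} (s : ℝ) (w : Fin q → ℝ) (j : Fin q) (k : Fin (q + 1)) :
    shearMatrix s w j.succ k = if j.succ = k then s else 0 := by
  simp [shearMatrix, Matrix.vecMulVec_apply, Matrix.one_apply]

theorem shearMatrix_mul_transpose_apply {q : ℕ} (s : ℝ) (w : Fin q → ℝ) (j : Fin q) :
    (shearMatrix s w * (shearMatrix s w).transpose) j.succ 0 = s ^ 2 * w j := by
  simp [Matrix.mul_apply, shearMatrix_apply_succ, shearMatrix_apply_zero]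
  ring

theorem toEuclideanCLM_shearMatrix {q : ℕ} (s : ℝ) (w : Fin q → ℝ) (y : ℝ) (z : Fin q → ℝ) :
    Matrix.toEuclideanCLM (n := Fin (q + 1)) (𝕜 := ℝ) (shearMatrix s w)
        (WithLp.toLp 2 (Fin.cons y z)) =
      WithLp.toLp 2 (s • Fin.cons (y + ∑ j, w j * z j) z) := by
  ext i
  rw [Matrix.toEuclideanCLM_toLp]
  refine Fin.cases ?_ (fun j => ?_) i
  · simp [Matrix.mulVec, dotProduct, Fin.sum_univ_succ, shearMatrix_apply_zero,
      shearMatrix_apply_zero_zero, mul_add, Finset.mul_sum, mul_assoc]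
  · simp [Matrix.mulVec, dotProduct, shearMatrix_apply_succ]

theorem opNorm_shearMatrix_le {q : ℕ} {s : ℝ} (hs : 0 ≤ s) {w : Fin q → ℝ}
    (hw : ∑ j, w j ^ 2 ≤ 1) : opNorm (shearMatrix s w) ≤ 2 * s := by
  have hN : opNorm (Matrix.vecMulVec (Pi.single 0 1) (Fin.cons 0 w) :
      Matrix (Fin (q + 1)) (Fin (q + 1)) ℝ) ≤ 1 := by
    refine ContinuousLinearMap.opNorm_le_bound _ zero_le_one fun x => ?_
    have : Matrix.toEuclideanCLM (n := Fin (q + 1)) (𝕜 := ℝ)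
        (Matrix.vecMulVec (Pi.single 0 1) (Fin.cons 0 w)) x =
          EuclideanSpace.single 0 (∑ j, w j * x j.succ) := by
      ext k
      refine Fin.cases ?_ (fun j => ?_) k <;>
      simp [Matrix.mulVec, dotProduct, Fin.sum_univ_succ, Matrix.vecMulVec_apply]
    rw [this, PiLp.norm_single, one_mul, Real.norm_eq_abs]
    refine abs_le_of_sq_le_sq ?_ (norm_nonneg x)
    calc (∑ j, w j * x j.succ) ^ 2 ≤ (∑ j, w j ^ 2) * ∑ j : Fin q, x j.succ ^ 2 :=
          Finset.sum_mul_sq_le_sq_mul_sq _ _ _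
      _ ≤ 1 * ∑ j : Fin q, x j.succ ^ 2 := by gcongr
      _ ≤ ‖x‖ ^ 2 := by
          rw [EuclideanSpace.norm_sq_eq, Fin.sum_univ_succ, one_mul]
          simp only [Real.norm_eq_abs, sq_abs]
          linarith [sq_nonneg (x 0)]
  have h1 : opNorm (1 : Matrix (Fin (q + 1)) (Fin (q + 1)) ℝ) ≤ 1 := by
    unfold opNorm
    rw [map_one]
    exact ContinuousLinearMap.norm_id_le
  calc opNorm (shearMatrix s w) = s * opNorm (1 + Matrix.vecMulVec (Pi.single 0 1)
        (Fin.cons 0 w) : Matrix (Fin (q + 1)) (Fin (q + 1)) ℝ) := by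
        unfold opNorm shearMatrix
        rw [map_smul, norm_smul, Real.norm_of_nonneg hs]
    _ ≤ s * 2 := by
        gcongr
        linarith [opNorm_add_le (1 : Matrix (Fin (q + 1)) (Fin (q + 1)) ℝ)
          (Matrix.vecMulVec (Pi.single 0 1) (Fin.cons 0 w))]
    _ = _ := mul_comm _ _

theorem mul_transpose_mem_boundedSpectrumClass {p : ℕ} {L : Matrix (Fin p) (Fin p) ℝ} {M : ℝ}
    (hL : opNorm L ^ 2 ≤ M) : L * L.transpose ∈ boundedSpectrumClass p M := by
  refine ⟨by simpa using Matrix.posSemidef_self_mul_conjTranspose L, le_trans ?_ hL⟩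
  have : L.transpose = star L := by
    rw [Matrix.star_eq_conjTranspose, Matrix.conjTranspose_eq_transpose_of_trivial]
  unfold opNorm
  rw [this, map_mul, map_star, sq]
  exact (norm_mul_le _ _).trans (mul_le_mul_of_nonneg_left
    (ContinuousLinearMap.adjoint.norm_map _).le (norm_nonneg _))

theorem lintegral_multivariateGaussian_shear {q : ℕ} (s : ℝ) (w : Fin q → ℝ)
    {f : EuclideanSpace ℝ (Fin (q + 1)) → ℝ≥0∞} (hf : Measurable f) :
    ∫⁻ x, f x ∂(multivariateGaussian 0 (shearMatrix s w * (shearMatrix s w).transpose)) =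
      ∫⁻ z, ∫⁻ y, f (WithLp.toLp 2 (s • (Fin.cons (y + ∑ j, w j * z j) z : Fin (q + 1) → ℝ)))
        ∂(gaussianReal 0 1) ∂(Measure.pi fun _ : Fin q => gaussianReal 0 1) := by
  have e := (measurePreserving_piFinSuccAbove (fun _ : Fin (q + 1) => gaussianReal 0 1) 0).symm
  rw [multivariateGaussian_mul_transpose, ← map_pi_eq_stdGaussian,
    Measure.map_map (by fun_prop) (by fun_prop), lintegral_map hf (by fun_prop), ← e.map_eq,
    lintegral_map (by fun_prop) (MeasurableEquiv.measurable _),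
    lintegral_prod_symm _ (by fun_prop)]
  refine lintegral_congr fun z => lintegral_congr fun y => ?_
  rw [← toEuclideanCLM_shearMatrix]
  simp [MeasurableEquiv.piFinSuccAbove, Fin.consEquiv]

/-- Given the other coordinates `z`, the two laws differ by a mean shift `c * z j`, with chi-square
constant `exp (c² z_j²)`. Averaging over Gaussian `z` gives a moment that is finite because `c ^ 2 <
1 / 2`. -/
theorem chiSqBound_shear {q : ℕ} (s : ℝ) {w w' : Fin q → ℝ} {c : ℝ} (j : Fin q)
    (hw : ∀ z : Fin q → ℝ, ∑ i, w' i * z i - ∑ i, w i * z i = c * z j) (hc : c ^ 2 < 1 / 2) :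
    ChiSqBound (multivariateGaussian 0 (shearMatrix s w * (shearMatrix s w).transpose))
      (multivariateGaussian 0 (shearMatrix s w' * (shearMatrix s w').transpose))
      (ENNReal.ofReal (√(1 - 2 * c ^ 2))⁻¹) := fun f hf => by
  rw [lintegral_multivariateGaussian_shear s w' hf,
    lintegral_multivariateGaussian_shear s w (hf.pow_const 2)]
  set F : ℝ → (Fin q → ℝ) → ℝ≥0∞ :=
    fun y z => f (WithLp.toLp 2 (s • (Fin.cons y z : Fin (q + 1) → ℝ))) with hF
  have hFm : Measurable (Function.uncurry F) := by
    refine hf.comp ((WithLp.measurable_toLp 2 _).comp (Measurable.const_smul ?_ s))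
    refine measurable_pi_lambda _ fun k => ?_
    refine Fin.cases ?_ (fun j => ?_) k
    · simpa using measurable_fst
    · simpa using (by fun_prop : Measurable fun c : ℝ × (Fin q → ℝ) => c.2 j)
  have hcond : ∀ z : Fin q → ℝ, (∫⁻ y, F (y + ∑ i, w' i * z i) z ∂(gaussianReal 0 1)) ^ 2 ≤
      (∫⁻ y, F (y + ∑ i, w i * z i) z ^ 2 ∂(gaussianReal 0 1)) *
        ENNReal.ofReal (Real.exp (c ^ 2 * z j ^ 2)) := fun z => by
    have hm : Measurable fun y => F y z := hFm.comp measurable_prodMk_right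
    have h := chiSqBound_gaussianReal_mean (∑ i, w i * z i) (∑ i, w' i * z i) _ hm
    rw [hw, mul_pow, mul_comm] at h
    have hmap : ∀ (m : ℝ) {g : ℝ → ℝ≥0∞}, Measurable g →
        ∫⁻ y, g (y + m) ∂(gaussianReal 0 1) = ∫⁻ y, g y ∂(gaussianReal m 1) := fun m g hg => by
      rw [← zero_add m, ← gaussianReal_map_add_const, lintegral_map hg (by fun_prop), zero_add]
    rw [hmap _ hm, hmap _ (g := fun y => F y z ^ 2) (hm.pow_const 2)]
    exact h
  have hg : Measurable fun z : Fin q → ℝ =>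
      ∫⁻ y, F (y + ∑ i, w i * z i) z ^ 2 ∂(gaussianReal 0 1) := by
    refine Measurable.lintegral_prod_right' (f := fun x : (Fin q → ℝ) × ℝ =>
      F (x.2 + ∑ i, w i * x.1 i) x.1 ^ 2) ?_
    have : Measurable fun x : (Fin q → ℝ) × ℝ => (x.2 + ∑ i, w i * x.1 i, x.1) := by fun_prop
    exact (hFm.comp this).pow_const 2
  have h := lintegral_mul_density_sq_le (Measure.pi fun _ : Fin q => gaussianReal 0 1)
    (f := fun _ => 1) measurable_const hg
    (k := fun z => ENNReal.ofReal (Real.exp (c ^ 2 * z j ^ 2))) (by fun_prop) hcond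
  simp only [one_mul, one_pow] at h
  have hk : ∫⁻ z, ENNReal.ofReal (Real.exp (c ^ 2 * z j ^ 2))
      ∂(Measure.pi fun _ : Fin q => gaussianReal 0 1) = ENNReal.ofReal (√(1 - 2 * c ^ 2))⁻¹ := by
    rw [← lintegral_exp_sq_gaussianReal hc]
    exact (measurePreserving_eval (fun _ : Fin q => gaussianReal 0 1) j).lintegral_comp
      (f := fun x => ENNReal.ofReal (Real.exp (c ^ 2 * x ^ 2))) (by fun_prop)
  rw [hk] at h
  exact h

/-! ### Choice of parameters in the three regimes -/

theorem one_le_ofReal_inv_sqrt {u : ℝ} (hu0 : 0 ≤ u) (hu1 : u < 1) :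
    1 ≤ ENNReal.ofReal (√(1 - u))⁻¹ := by
  rw [ENNReal.one_le_ofReal]
  exact (one_le_inv₀ (Real.sqrt_pos.2 (by linarith))).2 (Real.sqrt_le_one.2 (by linarith))

theorem ofReal_inv_sqrt_pow_le_two {u : ℝ} {n : ℕ} (hu : u ≤ 1) (hnu : n * u ≤ 1 / 2) :
    ENNReal.ofReal (√(1 - u))⁻¹ ^ n ≤ 2 := by
  -- Bernoulli's inequality; the target `2` becomes `1 / 4` after inverting and squaring away the
  -- root.
  have hb : 1 / 4 ≤ (1 - u) ^ n := by
    have := one_add_mul_le_pow (a := -u) (by linarith) n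
    rw [← sub_eq_add_neg] at this
    linarith
  rw [← ENNReal.ofReal_pow (by positivity), inv_pow, ← ENNReal.ofReal_ofNat 2]
  refine ENNReal.ofReal_le_ofReal (inv_le_of_inv_le₀ (by norm_num) ?_)
  refine (pow_le_pow_iff_left₀ (by norm_num) (by positivity) two_ne_zero).1 ?_
  rw [← pow_mul, mul_comm, pow_mul, Real.sq_sqrt (by linarith)]
  linarith

theorem le_minimaxErrorProb_of_two_le {q n : ℕ} {M δ ε r : ℝ} (hM : 0 ≤ M) (hε0 : 0 ≤ ε)
    (hε1 : ε ≤ 1) (hq : 1 ≤ q) (hn : 1 ≤ n) (hδ : 0 ≤ δ) (hqδ : q * δ ^ 2 ≤ 1)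
    (hnδ : n * δ ^ 2 ≤ 1 / 16) (hr : r ≤ (M / 4 * δ) ^ 2 * (q / 8)) :
    1 / 8 ≤ minimaxErrorProb n (q + 1) M ε r := by
  have : Nonempty (Fin q) := ⟨⟨0, hq⟩⟩
  let w : (Fin q → Bool) → Fin q → ℝ := fun v j => if v j then δ else -δ
  have hw : ∀ v j, w v j ^ 2 = δ ^ 2 := fun v j => by
    simp only [w]; split_ifs <;> ring
  have hn' : (1 : ℝ) ≤ n := by exact_mod_cast hn
  have hδ2 : δ ^ 2 ≤ 1 / 16 := le_trans (le_mul_of_one_le_left (sq_nonneg δ) hn') hnδ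
  have hs : (√M / 2) ^ 2 = M / 4 := by
    rw [div_pow, Real.sq_sqrt hM]; norm_num
  -- Lowering one sign changes a coefficient by `-(2 * δ)`, so `u = 8 δ²`, and `n δ² ≤ 1 / 16` is
  -- exactly `n u ≤ 1 / 2`. The scale `√M / 2` offsets the factor 2 in the norm of the shear.
  refine le_minimaxErrorProb_of_hypercube (a := 0) (d := M / 4 * δ)
    (B := ENNReal.ofReal (√(1 - 2 * (-(2 * δ)) ^ 2))⁻¹) hε0 hε1 (by positivity)
    (fun v => shearMatrix (√M / 2) (w v) * (shearMatrix (√M / 2) (w v)).transpose)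
    (fun v => mul_transpose_mem_boundedSpectrumClass ?_) Fin.succ (Fin.succ_injective q) 0
    (fun v i => ?_) (one_le_ofReal_inv_sqrt (by positivity) (by nlinarith))
    (ofReal_inv_sqrt_pow_le_two (by nlinarith) (by nlinarith)) (fun v i hv => ?_) (by simpa using hr)
  · have h := opNorm_shearMatrix_le (s := √M / 2) (by positivity) (w := w v) (by simpa [hw] using hqδ)
    calc _ ≤ (2 * (√M / 2)) ^ 2 := pow_le_pow_left₀ (opNorm_nonneg _) h 2
      _ = M := by rw [mul_pow, hs]; ring
  · rw [shearMatrix_mul_transpose_apply, hs]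
    simp only [w]
    split_ifs <;> ring
  · refine chiSqBound_shear _ i (fun z => ?_) (by nlinarith)
    rw [← Finset.sum_sub_distrib, Finset.sum_eq_single i]
    · simp only [w, hv, Function.update_self]
      simp
      ring
    · intro j _ hj
      simp [w, hj]
    · simp

theorem le_minimaxErrorProb_of_variance {n p : ℕ} (i : Fin p) {M t ε r : ℝ} (hM : 0 ≤ M)
    (hε0 : 0 ≤ ε) (hε1 : ε ≤ 1) (ht0 : 0 < t) (ht1 : t < 1) (hnt : n * t ^ 2 ≤ 1 / 2)
    (hr : r ≤ (M * t / 2) ^ 2 / 8) : 1 / 8 ≤ minimaxErrorProb n p M ε r := by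
  have hchi : ChiSqBound (multivariateGaussian 0 (Matrix.single i i M))
      (multivariateGaussian 0 (Matrix.single i i (M * (1 - t))))
      (ENNReal.ofReal (√(1 - t ^ 2))⁻¹) := by
    lift t to NNReal using ht0.le
    have h := chiSqBound_gaussianReal_var (t := t) ht0 ht1
    have hv : gaussianReal 0 (1 - t) = (gaussianReal 0 1).map (√(1 - (t : ℝ)) * ·) := by
      rw [gaussianReal_map_const_mul, mul_zero, mul_one]
      congr 1
      rw [← NNReal.coe_inj, NNReal.coe_sub ht1.le]
      exact (Real.sq_sqrt (sub_nonneg.2 ht1.le)).symm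
    rw [hv] at h
    have h1 : Matrix.single i i M = Matrix.single i i (√M ^ 2) := by rw [Real.sq_sqrt hM]
    have h2 : Matrix.single i i (M * (1 - t)) = Matrix.single i i ((√M * √(1 - t)) ^ 2) := by
      rw [mul_pow, Real.sq_sqrt hM, Real.sq_sqrt (by linarith)]
    rw [h1, h2, multivariateGaussian_single, multivariateGaussian_single]
    have h3 : (gaussianReal 0 1).map (√M * √(1 - t) * ·) =
        ((gaussianReal 0 1).map (√(1 - t) * ·)).map (√M * ·) := by
      rw [Measure.map_map (by fun_prop) (by fun_prop)]
      congr 1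
      ext x
      simp [mul_assoc]
    rw [h3]
    exact (h.map (by fun_prop)).map (measurable_euclideanSpace_single i)
  refine le_minimaxErrorProb_of_hypercube (ι := Unit) (a := M * (1 - t / 2)) (d := M * t / 2)
    hε0 hε1 (by positivity)
    (fun v => Matrix.single i i (if v () then M else M * (1 - t)))
    (fun v => single_mem_boundedSpectrumClass i ?_ ?_) (fun _ => i)
    (Function.injective_of_subsingleton _) i (fun v j => ?_)
    (one_le_ofReal_inv_sqrt (by positivity) (by nlinarith))
    (ofReal_inv_sqrt_pow_le_two (by nlinarith) hnt) (fun v j hv => ?_) (hr.trans (by simp [div_eq_mul_inv]))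
  · split_ifs
    · exact hM
    · exact mul_nonneg hM (by linarith)
  · split_ifs
    · exact le_rfl
    · exact mul_le_of_le_one_right hM (by linarith)
  · rw [Matrix.single_apply_same]
    split_ifs <;> ring
  · simpa [hv] using hchi

theorem le_minimaxErrorProb_of_contamination {n p : ℕ} (i : Fin p) {M ε r : ℝ} (hM : 0 ≤ M)
    (hε0 : 0 < ε) (hε1 : ε ≤ 1) (hr : r ≤ (M * ε / 2) ^ 2) :
    1 / 2 ≤ minimaxErrorProb n p M ε r := by
  have h1 : Matrix.single i i M = Matrix.single i i (√M ^ 2) := by rw [Real.sq_sqrt hM]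
  have h2 : Matrix.single i i (M * (1 - ε) ^ 2) = Matrix.single i i ((√M * (1 - ε)) ^ 2) := by
    rw [mul_pow, Real.sq_sqrt hM]
  have hle : ENNReal.ofReal (1 - ε) • multivariateGaussian 0 (Matrix.single i i (M * (1 - ε) ^ 2)) ≤
      multivariateGaussian 0 (Matrix.single i i M) := by
    rw [h1, h2, multivariateGaussian_single, multivariateGaussian_single]
    have h3 : (gaussianReal 0 1).map (√M * (1 - ε) * ·) =
        ((gaussianReal 0 1).map ((1 - ε) * ·)).map (√M * ·) := by
      rw [Measure.map_map (by fun_prop) (by fun_prop)]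
      congr 1
      ext x
      simp [mul_assoc]
    rw [h3, ← Measure.map_smul, ← Measure.map_smul]
    exact Measure.map_mono (Measure.map_mono (smul_gaussianReal_le (by linarith) (by linarith))
      (by fun_prop)) (measurable_euclideanSpace_single i)
  obtain ⟨Q', hQ'⟩ := exists_contamination _ _ hε0 hε1 hle
  -- Under the wide hypothesis the contamination is the wide Gaussian itself, so both mixtures equal
  -- it.
  let Q : ProbabilityMeasure (EuclideanSpace ℝ (Fin p)) :=
    ⟨multivariateGaussian 0 (Matrix.single i i M), inferInstance⟩
  have hε2 : (1 - ε) ^ 2 ≤ 1 := by nlinarith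
  refine le_minimaxErrorProb_of_contaminated_eq (d := M * ε / 2) hε0.le hε1
    (single_mem_boundedSpectrumClass i hM le_rfl)
    (single_mem_boundedSpectrumClass i (mul_nonneg hM (sq_nonneg _))
      (mul_le_of_le_one_right hM hε2)) Q Q' ?_ (by positivity) ?_ hr
  · unfold contaminated
    rw [hQ', ProbabilityMeasure.coe_mk, ← add_smul, ofReal_one_sub_add_ofReal hε0.le hε1, one_smul]
  · refine le_trans ?_ (abs_entry_le_opNorm _ i i)
    rw [Matrix.sub_apply, Matrix.single_apply_same, Matrix.single_apply_same]
    refine le_trans ?_ (le_abs_self _)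
    nlinarith [mul_nonneg hM (mul_nonneg hε0.le (sub_nonneg.2 hε1))]

theorem theorem3p2 (M K : ℝ) (hM : 0 < M) (hK : 0 < K) :
    ∃ C : ℝ, 0 < C ∧ ∃ c : ℝ, 0 < c ∧
      ∀ n p : ℕ, 1 ≤ n → 1 ≤ p → (p : ℝ) / n ≤ K →
        ∀ ε : ℝ, 0 ≤ ε → ε ≤ 1 →
          ENNReal.ofReal c ≤ minimaxErrorProb n p M ε (C * max ((p : ℝ) / n) (ε ^ 2)) := by
  -- With `δ² = c₀ / n`, the bound `1 / 16` controls the divergence and `1 / K` the spectrum.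
  set c₀ : ℝ := min (1 / 16) (1 / K) with hc₀
  have hc₀0 : 0 < c₀ := by positivity
  have hc₀1 : c₀ ≤ 1 / 16 := min_le_left _ _
  have hc₀K : c₀ * K ≤ 1 := (le_div_iff₀ hK).1 (min_le_right _ _)
  -- The cube gives `(M / 4)² δ² q / 8 = M² c₀ q / (128 n)`; `q + 1 ≤ 2 q` costs the last factor 2.
  refine ⟨M ^ 2 * c₀ / 256, by positivity, 1 / 8, by norm_num, fun n p hn hp hpn ε hε0 hε1 => ?_⟩
  have h8 : ENNReal.ofReal (1 / 8) = 1 / 8 := by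
    rw [ENNReal.ofReal_div_of_pos (by norm_num)]; simp
  rw [h8]
  have hn0 : (0 : ℝ) < n := by exact_mod_cast hn
  have hM2 : M ^ 2 * c₀ ≤ M ^ 2 / 16 := by nlinarith [sq_nonneg M]
  rcases le_total (ε ^ 2) ((p : ℝ) / n) with h | h
  · rw [max_eq_left h]
    obtain rfl | ⟨q, hq, rfl⟩ : p = 1 ∨ ∃ q, 1 ≤ q ∧ p = q + 1 := by
      rcases hp.eq_or_lt with h1 | h1
      · exact Or.inl h1.symm
      · exact Or.inr ⟨p - 1, by omega, by omega⟩
    · have hn1 : (1 : ℝ) ≤ n := by exact_mod_cast hn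
      have ht : √(1 / (2 * n)) ^ 2 = 1 / (2 * (n : ℝ)) := Real.sq_sqrt (by positivity)
      refine le_minimaxErrorProb_of_variance 0 (t := √(1 / (2 * n))) hM.le hε0 hε1 (by positivity)
        ?_ ?_ ?_
      · rw [Real.sqrt_lt' one_pos, one_pow, div_lt_one (by positivity)]
        linarith
      · rw [ht]; exact le_of_eq (by field_simp)
      · rw [div_pow, mul_pow, ht]
        calc M ^ 2 * c₀ / 256 * (((1 : ℕ) : ℝ) / n) ≤ M ^ 2 / 16 / 256 * (((1 : ℕ) : ℝ) / n) := by
              gcongr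
          _ ≤ M ^ 2 / 64 * (1 / n) := by
              push_cast
              gcongr ?_ * _
              linarith [sq_nonneg M]
          _ = _ := by field_simp; norm_num
    · have hδ : √(c₀ / n) ^ 2 = c₀ / n := Real.sq_sqrt (by positivity)
      have hq' : (1 : ℝ) ≤ q := by exact_mod_cast hq
      refine le_minimaxErrorProb_of_two_le hM.le hε0 hε1 hq hn (Real.sqrt_nonneg (c₀ / n)) ?_ ?_ ?_
      · rw [hδ]
        calc (q : ℝ) * (c₀ / n) ≤ c₀ * (((q + 1 : ℕ) : ℝ) / n) := by
              rw [mul_div_left_comm]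
              push_cast
              gcongr
              linarith
          _ ≤ c₀ * K := by gcongr
          _ ≤ 1 := hc₀K
      · rw [hδ, mul_div_cancel₀ _ hn0.ne']
        exact hc₀1
      · rw [mul_pow, hδ]
        calc M ^ 2 * c₀ / 256 * (((q + 1 : ℕ) : ℝ) / n) ≤ M ^ 2 * c₀ / 256 * (2 * q / n) := by
              push_cast
              gcongr
              linarith
          _ = _ := by field_simp; norm_num
  · rw [max_eq_right h]
    have hε : 0 < ε := by
      refine hε0.lt_of_ne fun h0 => ?_
      rw [← h0] at h
      have : (0 : ℝ) < (p : ℝ) / n := div_pos (by exact_mod_cast hp) hn0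
      norm_num at h
      linarith
    refine le_trans ?_ (le_minimaxErrorProb_of_contamination ⟨0, hp⟩ hM.le hε hε1 ?_)
    · rw [one_div, one_div, ENNReal.inv_le_inv]
      norm_num
    · nlinarith [mul_nonneg (sub_nonneg.2 hM2) (sq_nonneg ε), mul_nonneg (sq_nonneg M) (sq_nonneg ε)]
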